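/- Let $A\in\mathbb{R}^{n\times n}$, $B\in\mathbb{R}^{n\times m}$, let $$\Phi=\begin{bmatrix}A&B\\0&\mathbb{I}_m\end{bmatrix}$$ be the transition matrix of the augmented state $(x,u)\in\mathbb{R}^{n+m}$, let $H\in\mathbb{R}^{p\times(n+m)}$ be any measurement matrix (for instance $H=\begin{bmatrix}C&D\\0&\mathbb{I}_m\end{bmatrix}$), let $Q\in\mathbb{R}^{(n+m)\times(n+m)}$ be symmetric positive semidefinite (for instance $Q=\operatorname{diag}(\mathbb{O}_n,\tilde R^{-1})$ with $\tilde R\succ0$), and let $R\in\mathbb{R}^{p\times p}$ be symmetric positive definite. Define the Kalman filter covariances by $P_{0(-)}=Q$ and, for $k\ge0$, $$K_k=P_{k(-)}H^\top(HP_{k(-)}H^\top+R)^{-1},\quad P_{k(+)}=(\mathbb{I}-K_kH)P_{k(-)},\quad P_{k+1(-)}=\Phi P_{k(+)}\Phi^\top+Q .$$ For a horizon length $N$, define the Rauch–Tung–Striebel smoothed covariances by $P_{N[s]}^{[N]}=P_{N(+)}$ and, for $k=N-1,\dots,0$, $$L_k=P_{k(+)}\Phi^\top P_{k+1(-)}^{-1},\qquad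 P_{k[s]}^{[N]}=P_{k(+)}+L_k\bigl(P_{k+1[s]}^{[N]}-P_{k+1(-)}\bigr)L_k^\top ,$$ where $P_{k+1(-)}^{-1}$ is the Moore–Penrose inverse if $P_{k+1(-)}$ is singular. Let $\Psi_N=P_{0[s]}^{[N]}-P_{0[s]}^{[N-1]}$ for $N\ge1$. Then $\Psi_N$ converges to $\mathbb{O}$ geometrically as $N\to\infty$: $\Psi_N\to\mathbb{O}$, and there are constants $c>0$ and $r\in(0,1)$, depending on $A,B,H,Q,R$ but not on $N$, such that $\|\Psi_N\|\le c\,r^N$ for all $N\ge1$, where $\|\cdot\|$ is the $L^2$ operator norm. No stability, controllability, observability or detectability of the system is assumed. -/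

import Mathlib

open Matrix Filter Topology
open scoped Matrix.Norms.L2Operator

namespace ObservedControl

section PseudoInverse

variable {ι κ : Type*} [Fintype ι] [Fintype κ] [DecidableEq κ]

/-- The Moore-Penrose inverse `M⁺ = (MᵀM)⁺ Mᵀ` of a real matrix `M`. Here `(MᵀM)⁺` is the
spectral function `x ↦ x⁻¹` (with `0⁻¹ = 0`) of the symmetric matrix `MᵀM`. -/
noncomputable def pinv (M : Matrix ι κ ℝ) : Matrix κ ι ℝ :=
  cfc (fun x : ℝ => x⁻¹) (Mᵀ * M) * Mᵀ

/-- `pinv` satisfies the four Penrose equations. -/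
theorem pinv_penrose (M : Matrix ι κ ℝ) :
    M * pinv M * M = M ∧ pinv M * M * pinv M = pinv M ∧
      (M * pinv M)ᵀ = M * pinv M ∧ (pinv M * M)ᵀ = pinv M * M := by
  have hS : IsSelfAdjoint (Mᵀ * M) := by
    rw [IsSelfAdjoint, star_eq_conjTranspose, conjTranspose_eq_transpose_of_trivial]
    simp
  have hfin : (spectrum ℝ (Mᵀ * M)).Finite := Matrix.finite_real_spectrum
  have hc : ∀ f : ℝ → ℝ, ContinuousOn f (spectrum ℝ (Mᵀ * M)) := fun f => hfin.continuousOn f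
  obtain ⟨Y, hY⟩ : ∃ Y, Y = cfc (fun x : ℝ => x⁻¹) (Mᵀ * M) := ⟨_, rfl⟩
  have hYs : Yᵀ = Y := by
    have : IsSelfAdjoint Y := by rw [hY]; exact cfc_predicate _ _
    rw [IsSelfAdjoint, star_eq_conjTranspose, conjTranspose_eq_transpose_of_trivial] at this
    exact this
  have hid : cfc (fun x : ℝ => x) (Mᵀ * M) = Mᵀ * M := cfc_id' ℝ _ hS
  have hSY : (Mᵀ * M) * Y = cfc (fun x : ℝ => x * x⁻¹) (Mᵀ * M) := by
    rw [hY, cfc_mul (fun x : ℝ => x) (fun x : ℝ => x⁻¹) _ (hc _) (hc _), hid]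
  have hYS : Y * (Mᵀ * M) = (Mᵀ * M) * Y := by
    have h := congrArg Matrix.transpose hSY
    have hs : (cfc (fun x : ℝ => x * x⁻¹) (Mᵀ * M))ᵀ
        = cfc (fun x : ℝ => x * x⁻¹) (Mᵀ * M) := by
      have : IsSelfAdjoint (cfc (fun x : ℝ => x * x⁻¹) (Mᵀ * M)) := cfc_predicate _ _
      rw [IsSelfAdjoint, star_eq_conjTranspose, conjTranspose_eq_transpose_of_trivial] at this
      exact this
    rw [hs, ← hSY, transpose_mul, hYs, transpose_mul, transpose_transpose] at h
    exact h
  have hSYS : (Mᵀ * M) * Y * (Mᵀ * M) = Mᵀ * M := by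
    calc (Mᵀ * M) * Y * (Mᵀ * M)
        = cfc (fun x : ℝ => x * x⁻¹) (Mᵀ * M) * cfc (fun x : ℝ => x) (Mᵀ * M) := by rw [hSY, hid]
      _ = cfc (fun x : ℝ => x) (Mᵀ * M) := by
        rw [← cfc_mul (fun x : ℝ => x * x⁻¹) (fun x : ℝ => x) _ (hc _) (hc _)]
        refine cfc_congr fun x _ => ?_
        by_cases hx : x = 0 <;> simp [hx]
      _ = Mᵀ * M := hid
  have hYSY : Y * (Mᵀ * M) * Y = Y := by
    rw [Matrix.mul_assoc, hSY, hY, ← cfc_mul (fun x : ℝ => x⁻¹) _ _ (hc _) (hc _)]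
    refine cfc_congr fun x _ => ?_
    by_cases hx : x = 0 <;> simp [hx]
  have hp : pinv M = Y * Mᵀ := by rw [hY, pinv]
  have h1 : M * Y * Mᵀ * M = M := by
    have key : (M * Y * Mᵀ * M - M)ᵀ * (M * Y * Mᵀ * M - M) = 0 := by
      have h0 : Mᵀ * (M * Y * Mᵀ * M - M) = 0 := by
        rw [Matrix.mul_sub, sub_eq_zero]
        calc Mᵀ * (M * Y * Mᵀ * M) = (Mᵀ * M) * Y * (Mᵀ * M) := by simp only [Matrix.mul_assoc]
          _ = Mᵀ * M := hSYS
      have h2 : (M * Y * Mᵀ * M - M)ᵀ = (Mᵀ * M * Y - 1) * Mᵀ := by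
        simp [transpose_sub, transpose_mul, hYs, Matrix.sub_mul, Matrix.mul_assoc]
      rw [h2, Matrix.mul_assoc, h0, Matrix.mul_zero]
    have := conjTranspose_mul_self_eq_zero (A := M * Y * Mᵀ * M - M)
    rw [conjTranspose_eq_transpose_of_trivial] at this
    exact sub_eq_zero.mp (this.mp key)
  refine ⟨?_, ?_, ?_, ?_⟩
  · rw [hp, ← Matrix.mul_assoc, h1]
  · rw [hp]
    calc Y * Mᵀ * M * (Y * Mᵀ) = (Y * (Mᵀ * M) * Y) * Mᵀ := by simp only [Matrix.mul_assoc]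
      _ = Y * Mᵀ := by rw [hYSY]
  · rw [hp]; simp [transpose_mul, hYs, Matrix.mul_assoc]
  · rw [hp, Matrix.mul_assoc, transpose_mul, hYs, transpose_mul, transpose_transpose, hYS]

/-- For an invertible matrix, `pinv` is the ordinary inverse. -/
theorem pinv_eq_inv [DecidableEq ι] (M : Matrix ι ι ℝ) (hM : IsUnit M.det) : pinv M = M⁻¹ := by
  have h := (pinv_penrose M).1
  calc pinv M = M⁻¹ * (M * pinv M * M) * M⁻¹ := by
        rw [Matrix.mul_assoc M, Matrix.nonsing_inv_mul_cancel_left _ _ hM,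
          Matrix.mul_nonsing_inv_cancel_right _ _ hM]
    _ = M⁻¹ := by rw [h, Matrix.nonsing_inv_mul _ hM, Matrix.one_mul]

end PseudoInverse

/-- The augmented transition matrix `Φ = [[A, B], [0, I]]`, acting on the augmented state
`(x, u)`. -/
def augmentedTransition {n m : ℕ} (A : Matrix (Fin n) (Fin n) ℝ) (B : Matrix (Fin n) (Fin m) ℝ) :
    Matrix (Fin n ⊕ Fin m) (Fin n ⊕ Fin m) ℝ :=
  Matrix.fromBlocks A B 0 1

section Smoother

variable {ι κ : Type*} [Fintype ι] [DecidableEq ι] [Fintype κ] [DecidableEq κ]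

/-- The Kalman gain `K = P Hᵀ (H P Hᵀ + R)⁻¹` for the prior covariance `P`. -/
noncomputable def kalmanGain (H : Matrix κ ι ℝ) (R : Matrix κ κ ℝ) (P : Matrix ι ι ℝ) :
    Matrix ι κ ℝ :=
  P * Hᵀ * (H * P * Hᵀ + R)⁻¹

/-- The measurement update `(I - K H) P` of the prior covariance `P`. -/
noncomputable def measurementUpdate (H : Matrix κ ι ℝ) (R : Matrix κ κ ℝ) (P : Matrix ι ι ℝ) :
    Matrix ι ι ℝ :=
  (1 - kalmanGain H R P * H) * P

/-- The prior covariances `P_{k(-)}` of the Kalman filter, started at `P_{0(-)} = Q`. -/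
noncomputable def priorCov (Φ : Matrix ι ι ℝ) (H : Matrix κ ι ℝ) (Q : Matrix ι ι ℝ)
    (R : Matrix κ κ ℝ) : ℕ → Matrix ι ι ℝ
  | 0 => Q
  | k + 1 => Φ * measurementUpdate H R (priorCov Φ H Q R k) * Φᵀ + Q

/-- The posterior covariances `P_{k(+)}` of the Kalman filter. -/
noncomputable def postCov (Φ : Matrix ι ι ℝ) (H : Matrix κ ι ℝ) (Q : Matrix ι ι ℝ)
    (R : Matrix κ κ ℝ) (k : ℕ) : Matrix ι ι ℝ :=
  measurementUpdate H R (priorCov Φ H Q R k)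

/-- The Rauch-Tung-Striebel gain `L_k = P_{k(+)} Φᵀ P_{k+1(-)}⁻¹`. Since `Q` is usually singular,
so may be `P_{k+1(-)}`, and the inverse is then the Moore-Penrose one. -/
noncomputable def smootherGain (Φ : Matrix ι ι ℝ) (H : Matrix κ ι ℝ) (Q : Matrix ι ι ℝ)
    (R : Matrix κ κ ℝ) (k : ℕ) : Matrix ι ι ℝ :=
  postCov Φ H Q R k * Φᵀ * pinv (priorCov Φ H Q R (k + 1))

/-- `smoothedCov Φ H Q R j k` is the smoothed covariance `P_{k[s]}` at time `k` for the horizon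
`N = k + j`, so `j` counts the backward steps left to the end of the horizon:
`P_{N[s]} = P_{N(+)}` and `P_{k[s]} = P_{k(+)} + L_k (P_{k+1[s]} - P_{k+1(-)}) L_kᵀ`. -/
noncomputable def smoothedCov (Φ : Matrix ι ι ℝ) (H : Matrix κ ι ℝ) (Q : Matrix ι ι ℝ)
    (R : Matrix κ κ ℝ) : ℕ → ℕ → Matrix ι ι ℝ
  | 0, k => postCov Φ H Q R k
  | j + 1, k => postCov Φ H Q R k + smootherGain Φ H Q R k *
      (smoothedCov Φ H Q R j (k + 1) - priorCov Φ H Q R (k + 1)) * (smootherGain Φ H Q R k)ᵀ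

/-- The initial-time smoothed covariance `P_{0[s]}^{[N]}` for the horizon length `N`. -/
noncomputable def initialSmoothedCov (Φ : Matrix ι ι ℝ) (H : Matrix κ ι ℝ) (Q : Matrix ι ι ℝ)
    (R : Matrix κ κ ℝ) (N : ℕ) : Matrix ι ι ℝ :=
  smoothedCov Φ H Q R N 0

/-- The difference `Ψ_N = P_{0[s]}^{[N]} - P_{0[s]}^{[N-1]}`, meant for `N ≥ 1`. -/
noncomputable def covIncrement (Φ : Matrix ι ι ℝ) (H : Matrix κ ι ℝ) (Q : Matrix ι ι ℝ)
    (R : Matrix κ κ ℝ) (N : ℕ) : Matrix ι ι ℝ :=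
  initialSmoothedCov Φ H Q R N - initialSmoothedCov Φ H Q R (N - 1)

end Smoother

end ObservedControl

/-! Duality with optimal control. Write `Q = F * Fᵀ` and let `J_N` be the information about the
current state carried by `N` measurements (`backwardInfo`). By the matrix inversion lemma the
smoothed covariance at time 0 is "(Q⁻¹ + J_{N+1})⁻¹" (`smoothedCov_eq`, with `infoUpdate` giving
sense to the inverse of a singular `Q`). It depends on `J_{N+1}` only through `Fᵀ * J_{N+1} * F`, in
a Lipschitz way (`norm_infoUpdate_sub_le`), so convergence is needed only on the range of `F`.

The recursion of `J_N` is the value iteration for `x ↦ Φ x + F w` with stage cost `xᵀHᵀR⁻¹Hx + ‖w‖²`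
(`isValueIteration_backwardInfo`). Its values `V_N` increase with `N`. The range of `F` lies in the
reachable subspace `T`, on which every state can be steered to 0, so the `V_N` are bounded there
without any assumption on the system. Their kernels stabilize, hence `V_M ≤ C V_n` on `T` for one
`n` and all `M` (`exists_dominating`). The first `n` stages of an optimal control thus absorb at
least the fraction `1/C` of the cost, and the relative gap between `V_N` and the later values
shrinks by `1 - 1/C` every `n` stages (`dominating_contract`). -/

namespace ObservedControl

/-! ### Geometric convergence of linear-quadratic value iteration on the reachable subspace. -/

section ValueIteration

variable {E W G : Type*} [NormedAddCommGroup E] [NormedSpace ℝ E]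
  [NormedAddCommGroup W] [NormedSpace ℝ W]
  [NormedAddCommGroup G] [NormedSpace ℝ G]

/-- The seminorms `x ↦ ‖L N x‖` are the square roots of the value functions of the linear-quadratic
problem with dynamics `x ↦ Φ x + F w`, stage cost `q x + ‖w‖ ^ 2` and zero terminal cost. -/
structure IsValueIteration (Φ : E →ₗ[ℝ] E) (F : W →ₗ[ℝ] E) (q : E → ℝ) (L : ℕ → E →L[ℝ] G) :
    Prop where
  zero : ∀ x, L 0 x = 0
  le : ∀ N x w, ‖L (N + 1) x‖ ^ 2 ≤ q x + ‖w‖ ^ 2 + ‖L N (Φ x + F w)‖ ^ 2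
  attained : ∀ N x, ∃ w, ‖L (N + 1) x‖ ^ 2 = q x + ‖w‖ ^ 2 + ‖L N (Φ x + F w)‖ ^ 2

/-- The subspace of states reachable from `0` in `d` steps. -/
def reachable (Φ : E →ₗ[ℝ] E) (F : W →ₗ[ℝ] E) : ℕ → Submodule ℝ E
  | 0 => ⊥
  | d + 1 => reachable Φ F d ⊔ (LinearMap.range F).map (Φ ^ d)

theorem reachable_mono (Φ : E →ₗ[ℝ] E) (F : W →ₗ[ℝ] E) : Monotone (reachable Φ F) :=
  monotone_nat_of_le_succ fun _ => le_sup_left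

theorem map_reachable_le (Φ : E →ₗ[ℝ] E) (F : W →ₗ[ℝ] E) (d : ℕ) :
    (reachable Φ F d).map Φ ≤ reachable Φ F (d + 1) := by
  induction d with
  | zero => simp [reachable]
  | succ d ih =>
    rw [reachable, Submodule.map_sup]
    refine sup_le (ih.trans (reachable_mono Φ F (Nat.le_succ _))) ?_
    refine le_trans (le_of_eq ?_) (le_sup_right (a := reachable Φ F (d + 1)))
    rw [← Submodule.map_comp, pow_succ', Module.End.mul_eq_comp]

/-- In finite dimension the reachable states form an invariant subspace containing the range of the
input map. -/
theorem exists_reachable_stable [FiniteDimensional ℝ E] (Φ : E →ₗ[ℝ] E) (F : W →ₗ[ℝ] E) :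
    ∃ d, (∀ x ∈ reachable Φ F d, Φ x ∈ reachable Φ F d) ∧ ∀ w, F w ∈ reachable Φ F d := by
  obtain ⟨d, hd⟩ := WellFoundedGT.monotone_chain_condition ⟨reachable Φ F, reachable_mono Φ F⟩
  have h1 : reachable Φ F d = reachable Φ F (d + 1) := hd _ (Nat.le_succ _)
  refine ⟨d, fun x hx => ?_, fun w => ?_⟩
  · rw [h1]
    exact map_reachable_le Φ F d (Submodule.mem_map_of_mem hx)
  · rw [h1]
    apply reachable_mono Φ F (Nat.le_add_left 1 d)
    rw [reachable]
    exact Submodule.mem_sup_right ⟨F w, ⟨w, rfl⟩, by simp⟩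

namespace IsValueIteration

variable {Φ : E →ₗ[ℝ] E} {F : W →ₗ[ℝ] E} {q : E → ℝ} {L : ℕ → E →L[ℝ] G}

/-- An optimal first input for the longer horizon is admissible for the shorter one; the comparison
then passes to the next state, down to the zero terminal cost. -/
theorem mono (h : IsValueIteration Φ F q L) (x : E) : Monotone fun N => ‖L N x‖ ^ 2 := by
  refine monotone_nat_of_le_succ fun N => ?_
  induction N generalizing x with
  | zero => rw [h.zero]; simp
  | succ N ih =>
    obtain ⟨w, hw⟩ := h.attained (N + 1) x
    rw [hw]
    have := h.le N x w
    have := ih (Φ x + F w)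
    linarith

/-- The value functions are bounded at a state that can be steered to `0`. -/
theorem bounded_of_pow_mem (h : IsValueIteration Φ F q L) (d : ℕ) (x : E)
    (hx : (Φ ^ d) x ∈ reachable Φ F d) : ∃ C, ∀ N, ‖L N x‖ ^ 2 ≤ C := by
  induction d generalizing x with
  | zero =>
    have hx0 : x = 0 := by simpa [reachable] using hx
    exact ⟨0, fun N => by simp [hx0]⟩
  | succ d ih =>
    rw [reachable, Submodule.mem_sup] at hx
    obtain ⟨y, hy, z, ⟨_, ⟨w, rfl⟩, rfl⟩, hyz⟩ := hx
    -- The input `-w` cancels the component `Φ ^ d (F w)` of `Φ ^ (d + 1) x`, leaving `y`, which is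
    -- reachable in `d` steps.
    obtain ⟨C, hC⟩ := ih (Φ x + F (-w)) (by
      have : (Φ ^ d) (Φ x + F (-w)) = y := by
        rw [pow_succ, Module.End.mul_apply] at hyz
        rw [map_add, ← hyz, map_neg, map_neg]
        abel
      rwa [this])
    refine ⟨q x + ‖-w‖ ^ 2 + C, fun N => (h.mono x (Nat.le_succ N)).trans ?_⟩
    have := h.le N x (-w)
    have := hC N
    simp only at *
    linarith

/-- Optimal control over `k` stages with accumulated cost `s` and final state `x'`. -/
theorem multistage (h : IsValueIteration Φ F q L) {T : Submodule ℝ E}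
    (hΦ : ∀ x ∈ T, Φ x ∈ T) (hF : ∀ w, F w ∈ T) (N k : ℕ) (x : E) (hx : x ∈ T) :
    ∃ x' ∈ T, ∃ s : ℝ, ‖L (N + k) x‖ ^ 2 = s + ‖L N x'‖ ^ 2 ∧
      ∀ M, ‖L (M + k) x‖ ^ 2 ≤ s + ‖L M x'‖ ^ 2 := by
  induction k generalizing x with
  | zero => exact ⟨x, hx, 0, by simp, by simp⟩
  | succ k ih =>
    obtain ⟨w, hw⟩ := h.attained (N + k) x
    obtain ⟨x', hx', s, hs, hM⟩ := ih (Φ x + F w) (T.add_mem (hΦ x hx) (hF w))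
    refine ⟨x', hx', q x + ‖w‖ ^ 2 + s, ?_, fun M => ?_⟩
    · rw [← add_assoc, hw, hs]; ring
    · have h1 := h.le (M + k) x w
      have h2 := hM M
      rw [← add_assoc]
      linarith

/-- On a subspace where they are pointwise bounded, all value functions are dominated by a multiple
of a single one. -/
theorem exists_dominating [FiniteDimensional ℝ E] (h : IsValueIteration Φ F q L) {T : Submodule ℝ E}
    (hT : ∀ x ∈ T, ∃ C, ∀ N, ‖L N x‖ ^ 2 ≤ C) :
    ∃ B : ℝ, 0 < B ∧ (∀ N, ∀ x ∈ T, ‖L N x‖ ^ 2 ≤ B * ‖x‖ ^ 2) ∧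
      ∃ (n : ℕ) (C : ℝ), 0 < n ∧ 1 < C ∧ ∀ M, ∀ x ∈ T, ‖L M x‖ ^ 2 ≤ C * ‖L n x‖ ^ 2 := by
  have : CompleteSpace T := FiniteDimensional.complete ℝ T
  -- Since the values are squared norms of linear maps, pointwise boundedness on `T` becomes
  -- uniform.
  obtain ⟨b, hb⟩ := banach_steinhaus (g := fun N => (L N).comp T.subtypeL) (by
    rintro ⟨x, hx⟩
    obtain ⟨C, hC⟩ := hT x hx
    refine ⟨√C, fun N => ?_⟩
    exact Real.le_sqrt_of_sq_le (hC N))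
  have hb0 : 0 ≤ b := (norm_nonneg _).trans (hb 0)
  have hbT : ∀ N, ∀ x ∈ T, ‖L N x‖ ≤ b * ‖x‖ := fun N x hx =>
    (((L N).comp T.subtypeL).le_opNorm ⟨x, hx⟩).trans
      (mul_le_mul_of_nonneg_right (hb N) (norm_nonneg _))
  have hanti : Antitone fun N => LinearMap.ker (L N : E →ₗ[ℝ] G) := fun M N hMN x hx => by
    have h1 := h.mono x hMN
    have h2 : L N x = 0 := hx
    simp only [h2, norm_zero] at h1
    have h3 : ‖L M x‖ = 0 := by nlinarith [norm_nonneg (L M x)]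
    exact norm_eq_zero.mp h3
  obtain ⟨n, hn⟩ := WellFoundedLT.antitone_chain_condition hanti
  have hker : ∀ M x, L n x = 0 → L M x = 0 := fun M x hx => by
    rcases le_total n M with hM | hM
    · exact (hn M hM).le (show x ∈ LinearMap.ker (L n : E →ₗ[ℝ] G) from hx)
    · exact hanti hM (show x ∈ LinearMap.ker (L n : E →ₗ[ℝ] G) from hx)
  let f : T →ₗ[ℝ] G := (L n : E →ₗ[ℝ] G).comp T.subtype
  -- The lift `X (L n x)` differs from `x` by an element of the kernel of `L n`, invisible to every
  -- `L M`, and its norm is at most a multiple of `‖L n x‖`.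
  obtain ⟨X, hX⟩ := f.rangeRestrict.exists_rightInverse_of_surjective f.range_rangeRestrict
  let X' : LinearMap.range f →L[ℝ] T := LinearMap.toContinuousLinearMap X
  -- Passing to `n + 1` and adding 1 or 2 to the constants only secures the strict inequalities.
  refine ⟨b ^ 2 + 1, by positivity, fun N x hx => ?_, n + 1, (b * ‖X'‖) ^ 2 + 2, by omega,
    by nlinarith [sq_nonneg (b * ‖X'‖)], fun M x hx => ?_⟩
  · have := pow_le_pow_left₀ (norm_nonneg _) (hbT N x hx) 2
    nlinarith [sq_nonneg ‖x‖]
  · set y : T := X (f.rangeRestrict ⟨x, hx⟩) with hy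
    have h1 : f.rangeRestrict y = f.rangeRestrict ⟨x, hx⟩ :=
      LinearMap.congr_fun hX (f.rangeRestrict ⟨x, hx⟩)
    have h2 : L n (y : E) = L n x := congrArg Subtype.val h1
    have h3 : L M (y : E) = L M x := by
      have := hker M (y - x) (by rw [map_sub, h2, sub_self])
      rwa [map_sub, sub_eq_zero] at this
    have h4 : ‖L M x‖ ≤ b * (‖X'‖ * ‖L n x‖) := by
      rw [← h3]
      exact (hbT M y y.2).trans (mul_le_mul_of_nonneg_left (X'.le_opNorm _) hb0)
    have h5 : ‖L n x‖ ^ 2 ≤ ‖L (n + 1) x‖ ^ 2 := h.mono x (Nat.le_succ n)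
    have h6 := pow_le_pow_left₀ (norm_nonneg _) h4 2
    have h7 : (b * (‖X'‖ * ‖L n x‖)) ^ 2 = (b * ‖X'‖) ^ 2 * ‖L n x‖ ^ 2 := by ring
    have h8 := mul_le_mul_of_nonneg_left h5 (sq_nonneg (b * ‖X'‖))
    nlinarith [sq_nonneg ‖L (n + 1) x‖]

/-- A domination constant contracts over the stages of an optimal control. -/
theorem dominating_contract (h : IsValueIteration Φ F q L) {T : Submodule ℝ E}
    (hΦ : ∀ x ∈ T, Φ x ∈ T) (hF : ∀ w, F w ∈ T) {n : ℕ} {C : ℝ} (hC : 1 < C)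
    (hn : ∀ M, ∀ x ∈ T, ‖L M x‖ ^ 2 ≤ C * ‖L n x‖ ^ 2) {N : ℕ} {a : ℝ} (ha : 0 ≤ a)
    (hN : ∀ M, ∀ x ∈ T, ‖L M x‖ ^ 2 ≤ (1 + a) * ‖L N x‖ ^ 2) (M : ℕ) (x : E) (hx : x ∈ T) :
    ‖L M x‖ ^ 2 ≤ (1 + a * (1 - C⁻¹)) * ‖L (N + n) x‖ ^ 2 := by
  obtain ⟨x', hx', s, hs, hM⟩ := h.multistage hΦ hF N n x hx
  -- With horizon `M = 0` beyond the first `n` stages there is no tail, so `s` is at least the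
  -- optimal `n`-stage cost.
  have h1 : ‖L n x‖ ^ 2 ≤ s := by simpa [h.zero] using hM 0
  have h2 : ‖L M x‖ ^ 2 ≤ ‖L (M + n) x‖ ^ 2 := h.mono x (Nat.le_add_right M n)
  have h3 := hM M
  have h4 := hN M x' hx'
  have h5 : C⁻¹ * ‖L (N + n) x‖ ^ 2 ≤ ‖L n x‖ ^ 2 := by
    rw [inv_mul_le_iff₀ (by linarith)]
    exact hn _ x hx
  have h6 : ‖L N x'‖ ^ 2 ≤ (1 - C⁻¹) * ‖L (N + n) x‖ ^ 2 := by linarith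
  have h7 := mul_le_mul_of_nonneg_left h6 ha
  linarith

/-- The value iteration converges geometrically on the range of the input map. -/
theorem exists_geometric [FiniteDimensional ℝ E] (h : IsValueIteration Φ F q L) (F' : W →L[ℝ] E)
    (hF' : (F' : W →ₗ[ℝ] E) = F) :
    ∃ c r : ℝ, 0 < c ∧ 0 < r ∧ r < 1 ∧ ∀ N w,
      ‖L (N + 1) (F w)‖ ^ 2 - ‖L N (F w)‖ ^ 2 ≤ c * r ^ N * ‖w‖ ^ 2 := by
  obtain ⟨d, hΦ, hF⟩ := exists_reachable_stable Φ F
  set T := reachable Φ F d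
  have hpow : ∀ (k : ℕ), ∀ x ∈ T, (Φ ^ k) x ∈ T := by
    intro k
    induction k with
    | zero => simp
    | succ k ih =>
      intro x hx
      rw [pow_succ', Module.End.mul_apply]
      exact hΦ _ (ih x hx)
  obtain ⟨B, hB, hBT, n, C, hn, hC, hdom⟩ := h.exists_dominating
    (fun x hx => h.bounded_of_pow_mem d x (hpow d x hx))
  have hθ0 : 0 < 1 - C⁻¹ := sub_pos.mpr (inv_lt_one_of_one_lt₀ hC)
  have hθ1 : 1 - C⁻¹ < 1 := sub_lt_self _ (by positivity)
  -- The `n`-th root turns a contraction over `n` stages into a rate per stage.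
  obtain ⟨r, hr⟩ : ∃ r : ℝ, r = (1 - C⁻¹) ^ ((n : ℝ)⁻¹) := ⟨_, rfl⟩
  have hr0 : 0 < r := hr ▸ Real.rpow_pos_of_pos hθ0 _
  have hr1 : r < 1 := hr ▸ Real.rpow_lt_one hθ0.le hθ1 (by positivity)
  have hrn : r ^ n = 1 - C⁻¹ := hr ▸ Real.rpow_inv_natCast_pow hθ0.le hn.ne'
  have hC0 : 0 < C := by linarith
  have key : ∀ N, n ≤ N → ∀ M, ∀ x ∈ T,
      ‖L M x‖ ^ 2 ≤ (1 + C / r ^ (2 * n) * r ^ N) * ‖L N x‖ ^ 2 := by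
    intro N
    induction N using Nat.strong_induction_on with
    | _ N ih =>
      intro hN M x hx
      -- For `n ≤ N < 2n` the prefactor `C / r ^ (2 * n)` makes the bound at least `C`; beyond that,
      -- the induction goes back `n` stages.
      rcases lt_or_ge N (2 * n) with hlt | hge
      · have h1 : ‖L n x‖ ^ 2 ≤ ‖L N x‖ ^ 2 := h.mono x hN
        have h2 : r ^ (2 * n) ≤ r ^ N := pow_le_pow_of_le_one hr0.le hr1.le hlt.le
        have h3 : C ≤ 1 + C / r ^ (2 * n) * r ^ N := by
          rw [div_mul_eq_mul_div]
          have : C ≤ C * r ^ N / r ^ (2 * n) := by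
            rw [le_div_iff₀ (by positivity)]
            exact mul_le_mul_of_nonneg_left h2 hC0.le
          linarith
        calc ‖L M x‖ ^ 2 ≤ C * ‖L n x‖ ^ 2 := hdom M x hx
          _ ≤ C * ‖L N x‖ ^ 2 := mul_le_mul_of_nonneg_left h1 hC0.le
          _ ≤ _ := mul_le_mul_of_nonneg_right h3 (sq_nonneg _)
      · obtain ⟨K, rfl⟩ : ∃ K, N = K + n := ⟨N - n, by omega⟩
        have h1 := h.dominating_contract hΦ hF hC hdom
          (a := C / r ^ (2 * n) * r ^ K) (by positivity) (ih K (by omega) (by omega)) M x hx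
        rwa [← hrn, mul_assoc, ← pow_add] at h1
  have hFw : ∀ w, ‖F w‖ ^ 2 ≤ ‖F'‖ ^ 2 * ‖w‖ ^ 2 := fun w => by
    rw [← hF', ← mul_pow]
    exact pow_le_pow_left₀ (norm_nonneg _) (F'.le_opNorm w) 2
  refine ⟨(C / r ^ (2 * n) + 1 / r ^ n) * B * (‖F'‖ ^ 2 + 1), r, by positivity, hr0, hr1,
    fun N w => ?_⟩
  have hBw : ∀ M, ‖L M (F w)‖ ^ 2 ≤ B * (‖F'‖ ^ 2 + 1) * ‖w‖ ^ 2 := fun M => by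
    have h1 := hBT M (F w) (hF w)
    have h2 := mul_le_mul_of_nonneg_left (hFw w) hB.le
    nlinarith [mul_nonneg hB.le (sq_nonneg ‖w‖)]
  have hD : 0 ≤ B * (‖F'‖ ^ 2 + 1) * ‖w‖ ^ 2 := by positivity
  suffices hs : ‖L (N + 1) (F w)‖ ^ 2 - ‖L N (F w)‖ ^ 2 ≤
      (C / r ^ (2 * n) + 1 / r ^ n) * r ^ N * (B * (‖F'‖ ^ 2 + 1) * ‖w‖ ^ 2) by
    refine hs.trans (le_of_eq ?_); ring
  -- Below `n` there is no domination; the term `1 / r ^ n` lets the uniform bound suffice.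
  rcases lt_or_ge N n with hlt | hge
  · have h1 : 1 ≤ (C / r ^ (2 * n) + 1 / r ^ n) * r ^ N := by
      have h2 : r ^ n ≤ r ^ N := pow_le_pow_of_le_one hr0.le hr1.le hlt.le
      have h3 : 1 ≤ 1 / r ^ n * r ^ N := by
        rw [one_div_mul_eq_div, le_div_iff₀ (by positivity), one_mul]; exact h2
      have h4 : 0 ≤ C / r ^ (2 * n) * r ^ N := by positivity
      rw [add_mul]; linarith
    have h5 := mul_le_mul_of_nonneg_right h1 hD
    have := hBw (N + 1)
    have := sq_nonneg ‖L N (F w)‖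
    linarith
  · have h1 := key N hge (N + 1) (F w) (hF w)
    have h2 : 0 ≤ C / r ^ (2 * n) * r ^ N := by positivity
    have h3 := mul_le_mul_of_nonneg_left (hBw N) h2
    have h4 : 0 ≤ 1 / r ^ n * r ^ N * (B * (‖F'‖ ^ 2 + 1) * ‖w‖ ^ 2) := by positivity
    rw [add_mul, add_mul]
    linarith

end IsValueIteration

end ValueIteration

/-! ### Information form of covariance updates, with singular covariances allowed. -/

section InformationForm

variable {ι κ : Type*} [Fintype ι] [DecidableEq ι] [Fintype κ] [DecidableEq κ]

open scoped MatrixOrder in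
theorem exists_eq_mul_transpose {P : Matrix ι ι ℝ} (hP : P.PosSemidef) :
    ∃ F : Matrix ι ι ℝ, P = F * Fᵀ := by
  obtain ⟨B, rfl⟩ := CStarAlgebra.nonneg_iff_eq_star_mul_self.mp hP.nonneg
  exact ⟨Bᵀ, by rw [transpose_transpose, star_eq_conjTranspose,
    conjTranspose_eq_transpose_of_trivial]⟩

theorem transpose_eq_self {ι : Type*} {P : Matrix ι ι ℝ} (hP : P.PosSemidef) : Pᵀ = P := by
  have := hP.isHermitian
  rwa [IsHermitian, conjTranspose_eq_transpose_of_trivial] at this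

theorem posSemidef_conj {ι κ : Type*} [Fintype ι] [Fintype κ] {P : Matrix ι ι ℝ} (hP : P.PosSemidef) (M : Matrix κ ι ℝ) :
    (M * P * Mᵀ).PosSemidef := by
  have := hP.mul_mul_conjTranspose_same M
  rwa [conjTranspose_eq_transpose_of_trivial] at this

theorem posSemidef_conj' {ι κ : Type*} [Fintype ι] [Fintype κ] {P : Matrix ι ι ℝ} (hP : P.PosSemidef) (M : Matrix ι κ ℝ) :
    (Mᵀ * P * M).PosSemidef := by
  have := hP.conjTranspose_mul_mul_same M
  rwa [conjTranspose_eq_transpose_of_trivial] at this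

theorem isUnit_det_one_add {P : Matrix ι ι ℝ} (hP : P.PosSemidef) : IsUnit (1 + P).det :=
  (PosDef.one.add_posSemidef hP).det_pos.ne'.isUnit

/-- `P * J` need not be symmetric, but Sylvester's identity replaces it by the semidefinite `Fᵀ * J
* F` with `P = F * Fᵀ`. -/
theorem isUnit_det_one_add_mul {P J : Matrix ι ι ℝ} (hP : P.PosSemidef) (hJ : J.PosSemidef) :
    IsUnit (1 + P * J).det := by
  obtain ⟨F, rfl⟩ := exists_eq_mul_transpose hP
  rw [Matrix.mul_assoc, det_one_add_mul_comm]
  exact isUnit_det_one_add (posSemidef_conj' hJ F)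

/-- The covariance `(P⁻¹ + J)⁻¹` of a state of prior covariance `P` after the information `J` about
it has been used, written so that `P` may be singular. -/
noncomputable def infoUpdate (P J : Matrix ι ι ℝ) : Matrix ι ι ℝ :=
  P * (1 + J * P)⁻¹

theorem infoUpdate_posSemidef {P J : Matrix ι ι ℝ} (hP : P.PosSemidef) (hJ : J.PosSemidef) :
    (infoUpdate P J).PosSemidef := by
  have hu := isUnit_det_one_add_mul hJ hP
  have h1 : (1 + J * P)ᵀ = 1 + P * J := by
    rw [transpose_add, transpose_mul, transpose_one, transpose_eq_self hP, transpose_eq_self hJ]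
  have h2 : (1 + P * J) * P = P * (1 + J * P) := by
    rw [Matrix.add_mul, Matrix.mul_add, Matrix.one_mul, Matrix.mul_one, Matrix.mul_assoc]
  have h3 : infoUpdate P J = ((1 + J * P)⁻¹)ᵀ * (P + Pᵀ * J * P) * (1 + J * P)⁻¹ := by
    have h4 : P + Pᵀ * J * P = (1 + J * P)ᵀ * P := by
      rw [h1, Matrix.add_mul, Matrix.one_mul, transpose_eq_self hP]
    rw [h4, ← Matrix.mul_assoc, ← transpose_mul, mul_nonsing_inv _ hu, transpose_one,
      Matrix.one_mul, infoUpdate]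
  rw [h3]
  exact posSemidef_conj' (hP.add (posSemidef_conj' hJ P)) _

theorem infoUpdate_infoUpdate {P J J' : Matrix ι ι ℝ} (hP : P.PosSemidef) (hJ : J.PosSemidef) :
    infoUpdate (infoUpdate P J) J' = infoUpdate P (J + J') := by
  have hu := isUnit_det_one_add_mul hJ hP
  rw [infoUpdate, infoUpdate, infoUpdate, Matrix.mul_assoc P, ← Matrix.mul_inv_rev, Matrix.add_mul,
    Matrix.one_mul, Matrix.mul_assoc J', Matrix.mul_assoc P, nonsing_inv_mul _ hu, Matrix.mul_one,
    add_assoc, ← Matrix.add_mul]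

/-- The matrix inversion lemma. -/
theorem infoUpdate_conj {P : Matrix ι ι ℝ} {M : Matrix κ κ ℝ} (hP : P.PosSemidef)
    (hM : M.PosSemidef) (H : Matrix κ ι ℝ) :
    infoUpdate P (Hᵀ * M * H) = P - P * Hᵀ * infoUpdate M (H * P * Hᵀ) * H * P := by
  have hD := isUnit_det_one_add_mul (posSemidef_conj' hM H) hP
  have hY := isUnit_det_one_add_mul (posSemidef_conj hP H) hM
  have h1 : H * P * (1 + Hᵀ * M * H * P) = (1 + H * P * Hᵀ * M) * (H * P) := by
    simp only [Matrix.mul_add, Matrix.add_mul, Matrix.mul_one, Matrix.one_mul, Matrix.mul_assoc]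
  have h2 : (1 + H * P * Hᵀ * M)⁻¹ * (H * P * (1 + Hᵀ * M * H * P)) = H * P := by
    rw [h1, nonsing_inv_mul_cancel_left _ _ hY]
  have h3 : (P - P * Hᵀ * infoUpdate M (H * P * Hᵀ) * H * P) * (1 + Hᵀ * M * H * P) = P := by
    have h4 : P * Hᵀ * infoUpdate M (H * P * Hᵀ) * H * P * (1 + Hᵀ * M * H * P)
        = P * Hᵀ * M * (H * P) := by
      conv_rhs => rw [← h2]
      rw [infoUpdate]
      simp only [Matrix.mul_assoc]
    rw [Matrix.sub_mul, h4]
    simp only [Matrix.mul_add, Matrix.mul_one, Matrix.mul_assoc, add_sub_cancel_right]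
  rw [infoUpdate]
  nth_rewrite 1 [← h3]
  rw [mul_nonsing_inv_cancel_right _ _ hD]

theorem measurementUpdate_eq_infoUpdate {P : Matrix ι ι ℝ} (hP : P.PosSemidef)
    {R : Matrix κ κ ℝ} (hR : R.PosDef) (H : Matrix κ ι ℝ) :
    measurementUpdate H R P = infoUpdate P (Hᵀ * R⁻¹ * H) := by
  have hu : IsUnit R.det := hR.det_pos.ne'.isUnit
  have h1 : infoUpdate R⁻¹ (H * P * Hᵀ) = (H * P * Hᵀ + R)⁻¹ := by
    rw [infoUpdate, ← Matrix.mul_inv_rev, Matrix.add_mul, Matrix.one_mul, Matrix.mul_assoc _ R⁻¹,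
      nonsing_inv_mul _ hu, Matrix.mul_one, add_comm]
  rw [infoUpdate_conj hP hR.inv.posSemidef, h1, measurementUpdate, kalmanGain, Matrix.sub_mul,
    Matrix.one_mul]

/-- Both quadratic forms are nonnegative and sum to 0, so that of `P` vanishes at `Φᵀ z`. This
kernel inclusion is what allows a Moore-Penrose inverse in the smoother gain. -/
theorem mul_transpose_mulVec_eq_zero {ι : Type*} [Fintype ι] {P Q : Matrix ι ι ℝ} (hP : P.PosSemidef)
    (hQ : Q.PosSemidef) (Φ : Matrix ι ι ℝ) {z : ι → ℝ} (hz : (Φ * P * Φᵀ + Q) *ᵥ z = 0) :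
    (P * Φᵀ) *ᵥ z = 0 := by
  have h1 : z ⬝ᵥ (Φ * P * Φᵀ) *ᵥ z + z ⬝ᵥ Q *ᵥ z = 0 := by
    rw [← dotProduct_add, ← add_mulVec, hz, dotProduct_zero]
  have h2 := (posSemidef_conj hP Φ).dotProduct_mulVec_nonneg z
  have h3 := hQ.dotProduct_mulVec_nonneg z
  rw [star_trivial] at h2 h3
  have h4 : z ⬝ᵥ (Φ * P * Φᵀ) *ᵥ z = 0 := by linarith
  rw [← mulVec_mulVec]
  refine (hP.dotProduct_mulVec_zero_iff _).mp ?_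
  rw [star_trivial, ← h4, dotProduct_comm, dotProduct_mulVec, vecMul_transpose, dotProduct_comm,
    mulVec_mulVec, mulVec_mulVec]

theorem mul_transpose_mul_pinv_mul {P Q : Matrix ι ι ℝ} (hP : P.PosSemidef)
    (hQ : Q.PosSemidef) (Φ : Matrix ι ι ℝ) :
    P * Φᵀ * pinv (Φ * P * Φᵀ + Q) * (Φ * P * Φᵀ + Q) = P * Φᵀ := by
  set S := Φ * P * Φᵀ + Q
  have h1 : P * Φᵀ * (1 - pinv S * S) = 0 := by
    refine ext_of_mulVec_single fun i => ?_
    rw [← mulVec_mulVec, zero_mulVec]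
    refine mul_transpose_mulVec_eq_zero hP hQ Φ ?_
    rw [mulVec_mulVec, Matrix.mul_sub, Matrix.mul_one, ← Matrix.mul_assoc, (pinv_penrose S).1,
      sub_self, zero_mulVec]
  rw [Matrix.mul_sub, Matrix.mul_one, sub_eq_zero] at h1
  rw [Matrix.mul_assoc, ← h1]

/-! ### Backward information and the smoother. -/

/-- The information about the current state in `N` measurements, the first one being taken now. -/
noncomputable def backwardInfo (Φ : Matrix ι ι ℝ) (H : Matrix κ ι ℝ) (Q : Matrix ι ι ℝ)
    (R : Matrix κ κ ℝ) : ℕ → Matrix ι ι ℝ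
  | 0 => 0
  | N + 1 => Hᵀ * R⁻¹ * H + Φᵀ * infoUpdate (backwardInfo Φ H Q R N) Q * Φ

variable {Φ : Matrix ι ι ℝ} {H : Matrix κ ι ℝ} {Q : Matrix ι ι ℝ} {R : Matrix κ κ ℝ}

theorem backwardInfo_posSemidef (hQ : Q.PosSemidef) (hR : R.PosDef) (N : ℕ) :
    (backwardInfo Φ H Q R N).PosSemidef := by
  induction N with
  | zero => exact PosSemidef.zero
  | succ N ih =>
    exact (posSemidef_conj' hR.inv.posSemidef H).add (posSemidef_conj' (infoUpdate_posSemidef ih hQ) Φ)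

theorem priorCov_posSemidef (hQ : Q.PosSemidef) (hR : R.PosDef) (k : ℕ) :
    (priorCov Φ H Q R k).PosSemidef := by
  induction k with
  | zero => exact hQ
  | succ k ih =>
    rw [priorCov, measurementUpdate_eq_infoUpdate ih hR]
    exact (posSemidef_conj (infoUpdate_posSemidef ih (posSemidef_conj' hR.inv.posSemidef H)) Φ).add hQ

/-- The Rauch-Tung-Striebel recursion in information form. -/
theorem smoothedCov_eq (hQ : Q.PosSemidef) (hR : R.PosDef) (j k : ℕ) :
    smoothedCov Φ H Q R j k = infoUpdate (priorCov Φ H Q R k) (backwardInfo Φ H Q R (j + 1)) := by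
  induction j generalizing k with
  | zero =>
    -- No backward steps still means one measurement, the current one: hence the index `j + 1`.
    rw [smoothedCov, postCov, measurementUpdate_eq_infoUpdate (priorCov_posSemidef hQ hR k) hR]
    simp [backwardInfo, infoUpdate]
  | succ j ih =>
    have hP := priorCov_posSemidef (Φ := Φ) (H := H) hQ hR k
    have hP' := priorCov_posSemidef (Φ := Φ) (H := H) hQ hR (k + 1)
    have hJ := backwardInfo_posSemidef (Φ := Φ) (H := H) hQ hR (j + 1)
    have hJ0 := posSemidef_conj' hR.inv.posSemidef H
    have hU := infoUpdate_posSemidef hP hJ0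
    have hpost : postCov Φ H Q R k = infoUpdate (priorCov Φ H Q R k) (Hᵀ * R⁻¹ * H) :=
      measurementUpdate_eq_infoUpdate hP hR H
    have hS : priorCov Φ H Q R (k + 1) = Φ * postCov Φ H Q R k * Φᵀ + Q := rfl
    rw [← hpost] at hU
    -- The current measurement is used first, giving the posterior; the inversion lemma then handles
    -- the future information pulled back by `Φ`.
    rw [smoothedCov, ih, backwardInfo.eq_2 Φ H Q R (j + 1), ← infoUpdate_infoUpdate hP hJ0, ← hpost,
      infoUpdate_conj hU (infoUpdate_posSemidef hJ hQ), infoUpdate_infoUpdate hJ hQ,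
      add_comm Q, ← hS]
    set P' := priorCov Φ H Q R (k + 1)
    set J := backwardInfo Φ H Q R (j + 1)
    set P₁ := postCov Φ H Q R k
    have h1 : infoUpdate P' J - P' = -(P' * infoUpdate J P' * P') := by
      have := infoUpdate_conj hP' hJ 1
      simp only [transpose_one, Matrix.one_mul, Matrix.mul_one] at this
      rw [this, sub_sub_cancel_left]
    -- By `h1` the gain enters only through its product with `P'`, where the pseudoinverse cancels.
    have h2 : smootherGain Φ H Q R k * P' = P₁ * Φᵀ := by
      rw [smootherGain]
      change P₁ * Φᵀ * pinv P' * P' = _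
      rw [hS]
      exact mul_transpose_mul_pinv_mul hU hQ Φ
    have h3 : P' * (smootherGain Φ H Q R k)ᵀ = Φ * P₁ := by
      have := congrArg transpose h2
      rwa [transpose_mul, transpose_mul, transpose_transpose, transpose_eq_self hU,
        transpose_eq_self hP'] at this
    rw [h1, Matrix.mul_neg, Matrix.neg_mul, ← sub_eq_add_neg]
    congr 1
    calc _ = (smootherGain Φ H Q R k * P') * infoUpdate J P'
          * (P' * (smootherGain Φ H Q R k)ᵀ) := by simp only [Matrix.mul_assoc]
      _ = _ := by rw [h2, h3]; simp only [Matrix.mul_assoc]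

theorem covIncrement_succ (hQ : Q.PosSemidef) (hR : R.PosDef) (N : ℕ) :
    covIncrement Φ H Q R (N + 1) = infoUpdate Q (backwardInfo Φ H Q R (N + 2))
      - infoUpdate Q (backwardInfo Φ H Q R (N + 1)) := by
  simp [covIncrement, initialSmoothedCov, smoothedCov_eq hQ hR, priorCov]

/-! ### Lipschitz dependence of the covariance on the information. -/

theorem infoUpdate_mul_transpose {J F : Matrix ι ι ℝ} (hJ : J.PosSemidef) :
    infoUpdate (F * Fᵀ) J = F * (1 + Fᵀ * J * F)⁻¹ * Fᵀ := by
  have h1 := isUnit_det_one_add (posSemidef_conj' hJ F)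
  have h2 : IsUnit (1 + J * (F * Fᵀ)).det := by
    rw [← Matrix.mul_assoc, det_one_add_mul_comm, ← Matrix.mul_assoc]
    exact h1
  have h3 : (1 + Fᵀ * J * F) * Fᵀ = Fᵀ * (1 + J * (F * Fᵀ)) := by
    simp only [Matrix.mul_add, Matrix.add_mul, Matrix.mul_one, Matrix.one_mul, Matrix.mul_assoc]
  have h4 : F * (1 + Fᵀ * J * F)⁻¹ * Fᵀ * (1 + J * (F * Fᵀ)) = F * Fᵀ := by
    rw [Matrix.mul_assoc _ Fᵀ, ← h3, Matrix.mul_assoc, nonsing_inv_mul_cancel_left _ _ h1]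
  rw [infoUpdate]
  nth_rewrite 1 [← h4]
  rw [mul_nonsing_inv_cancel_right _ _ h2]

/-- For `y = (1 + S)⁻¹ v`, `‖y‖² ≤ ⟨y, v⟩ ≤ ‖y‖ ‖v‖`. -/
theorem norm_inv_one_add_le {S : Matrix ι ι ℝ} (hS : S.PosSemidef) : ‖(1 + S)⁻¹‖ ≤ 1 := by
  have hu := isUnit_det_one_add hS
  rw [cstar_norm_def]
  refine ContinuousLinearMap.opNorm_le_bound _ zero_le_one fun v => ?_
  set y := toEuclideanCLM (n := ι) (𝕜 := ℝ) (1 + S)⁻¹ v with hy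
  have h1 : toEuclideanCLM (n := ι) (𝕜 := ℝ) (1 + S) y = v := by
    rw [hy, ← mul_apply_eq_comp, ← map_mul, mul_nonsing_inv _ hu, map_one]
    rfl
  have h2 : inner ℝ y v = ‖y‖ ^ 2 + y ⬝ᵥ S *ᵥ y := by
    rw [← inner_toEuclideanCLM, ← real_inner_self_eq_norm_sq, ← inner_add_right]
    conv_lhs => rw [← h1]
    rw [map_add, map_one]
    rfl
  have h3 := hS.dotProduct_mulVec_nonneg y
  rw [star_trivial] at h3
  have h4 := real_inner_le_norm y v
  rw [one_mul]
  by_contra! hlt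
  nlinarith [norm_nonneg v]

theorem norm_infoUpdate_sub_le {J J' F : Matrix ι ι ℝ} (hJ : J.PosSemidef)
    (hJ' : J'.PosSemidef) :
    ‖infoUpdate (F * Fᵀ) J' - infoUpdate (F * Fᵀ) J‖ ≤ ‖F‖ * ‖F‖ * ‖Fᵀ * J' * F - Fᵀ * J * F‖ := by
  have hu := isUnit_det_one_add (posSemidef_conj' hJ F)
  have hu' := isUnit_det_one_add (posSemidef_conj' hJ' F)
  have hn := norm_inv_one_add_le (posSemidef_conj' hJ F)
  have hn' := norm_inv_one_add_le (posSemidef_conj' hJ' F)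
  rw [infoUpdate_mul_transpose hJ, infoUpdate_mul_transpose hJ', ← Matrix.sub_mul,
    ← Matrix.mul_sub]
  set S := Fᵀ * J * F
  set S' := Fᵀ * J' * F
  have h1 : (1 + S')⁻¹ - (1 + S)⁻¹ = -((1 + S')⁻¹ * (S' - S) * (1 + S)⁻¹) := by
    have : S' - S = (1 + S') - (1 + S) := by abel
    rw [this, Matrix.mul_sub, Matrix.sub_mul, nonsing_inv_mul _ hu', Matrix.one_mul,
      mul_nonsing_inv_cancel_right _ _ hu, neg_sub]
  have hFt : ‖Fᵀ‖ = ‖F‖ := by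
    rw [← conjTranspose_eq_transpose_of_trivial, l2_opNorm_conjTranspose]
  have h2 : ‖(1 + S')⁻¹ - (1 + S)⁻¹‖ ≤ ‖S' - S‖ := by
    rw [h1, norm_neg]
    calc _ ≤ ‖(1 + S')⁻¹‖ * ‖S' - S‖ * ‖(1 + S)⁻¹‖ :=
          (norm_mul_le _ _).trans (mul_le_mul_of_nonneg_right (norm_mul_le _ _) (norm_nonneg _))
      _ ≤ 1 * ‖S' - S‖ * 1 := by gcongr
      _ = _ := by ring
  calc _ ≤ ‖F‖ * ‖(1 + S')⁻¹ - (1 + S)⁻¹‖ * ‖Fᵀ‖ :=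
        (norm_mul_le _ _).trans (mul_le_mul_of_nonneg_right (norm_mul_le _ _) (norm_nonneg _))
    _ ≤ ‖F‖ * ‖S' - S‖ * ‖F‖ := by rw [hFt]; gcongr
    _ = _ := by ring

/-! ### The Riccati recursion as value iteration, and the conclusion. -/

/-- Completion of squares in the Bellman equation. -/
theorem dotProduct_infoUpdate_add {J F : Matrix ι ι ℝ} (hJ : J.PosSemidef) (z w : ι → ℝ) :
    w ⬝ᵥ w + (z + F *ᵥ w) ⬝ᵥ J *ᵥ (z + F *ᵥ w) = z ⬝ᵥ infoUpdate J (F * Fᵀ) *ᵥ z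
      + ((w + Fᵀ *ᵥ infoUpdate J (F * Fᵀ) *ᵥ z) ⬝ᵥ (w + Fᵀ *ᵥ infoUpdate J (F * Fᵀ) *ᵥ z)
      + (F *ᵥ (w + Fᵀ *ᵥ infoUpdate J (F * Fᵀ) *ᵥ z)) ⬝ᵥ
        J *ᵥ (F *ᵥ (w + Fᵀ *ᵥ infoUpdate J (F * Fᵀ) *ᵥ z))) := by
  have hQ : (F * Fᵀ).PosSemidef := by
    have := posSemidef_conj (PosSemidef.one (n := ι) (R := ℝ)) F
    rwa [Matrix.mul_one] at this
  have hu := isUnit_det_one_add_mul hQ hJ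
  -- `y` is the state reached from `z` under the optimal input `-Fᵀ J y`; below, `d` is the
  -- deviation of `w` from that input.
  obtain ⟨y, hy⟩ : ∃ y, y = (1 + F * Fᵀ * J)⁻¹ *ᵥ z := ⟨_, rfl⟩
  have hM : infoUpdate J (F * Fᵀ) *ᵥ z = J *ᵥ y := by
    rw [infoUpdate, ← mulVec_mulVec, hy]
  have hz : z = y + F *ᵥ Fᵀ *ᵥ J *ᵥ y := by
    have : (1 + F * Fᵀ * J) *ᵥ y = z := by
      rw [hy, mulVec_mulVec, mul_nonsing_inv _ hu, one_mulVec]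
    rw [← this, add_mulVec, one_mulVec, mulVec_mulVec, mulVec_mulVec, Matrix.mul_assoc]
  rw [hM]
  obtain ⟨d, hd⟩ : ∃ d, d = w + Fᵀ *ᵥ J *ᵥ y := ⟨_, rfl⟩
  have hw : w = d - Fᵀ *ᵥ J *ᵥ y := by rw [hd, add_sub_cancel_right]
  have hzw : z + F *ᵥ w = y + F *ᵥ d := by
    rw [hw, mulVec_sub]
    nth_rewrite 1 [hz]
    abel
  have hadj : ∀ u v : ι → ℝ, (F *ᵥ u) ⬝ᵥ v = u ⬝ᵥ (Fᵀ *ᵥ v) := fun u v => by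
    rw [dotProduct_comm, dotProduct_mulVec, dotProduct_comm, mulVec_transpose]
  have hsymm : ∀ u v : ι → ℝ, u ⬝ᵥ J *ᵥ v = v ⬝ᵥ J *ᵥ u := fun u v => by
    rw [dotProduct_mulVec, dotProduct_comm, ← mulVec_transpose, transpose_eq_self hJ]
  rw [← hd, hzw, hw]
  nth_rewrite 1 [hz]
  have h1 := hsymm y (F *ᵥ d)
  have h2 := hadj d (J *ᵥ y)
  have h3 := hadj (Fᵀ *ᵥ J *ᵥ y) (J *ᵥ y)
  have h4 := dotProduct_comm d (Fᵀ *ᵥ J *ᵥ y)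
  simp only [mulVec_add, add_dotProduct, dotProduct_add, sub_dotProduct, dotProduct_sub]
  linarith

theorem dotProduct_mul_transpose_mulVec (Y : Matrix ι ι ℝ) (x : EuclideanSpace ℝ ι) :
    x ⬝ᵥ (Y * Yᵀ) *ᵥ x = ‖toEuclideanCLM (n := ι) (𝕜 := ℝ) Yᵀ x‖ ^ 2 := by
  rw [← real_inner_self_eq_norm_sq, inner_toEuclideanCLM, ofLp_toEuclideanCLM, ← mulVec_mulVec,
    dotProduct_mulVec, ← mulVec_transpose, dotProduct_mulVec, ← mulVec_transpose, transpose_transpose,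
    dotProduct_comm]

theorem isValueIteration_backwardInfo {F : Matrix ι ι ℝ} (hF : (F * Fᵀ).PosSemidef)
    (hR : R.PosDef) {Y : ℕ → Matrix ι ι ℝ}
    (hY : ∀ N, backwardInfo Φ H (F * Fᵀ) R N = Y N * (Y N)ᵀ) :
    IsValueIteration (E := EuclideanSpace ℝ ι) (W := EuclideanSpace ℝ ι)
      (G := EuclideanSpace ℝ ι) (toEuclideanCLM (n := ι) (𝕜 := ℝ) Φ).toLinearMap
      (toEuclideanCLM (n := ι) (𝕜 := ℝ) F).toLinearMap
      (fun x => x ⬝ᵥ (Hᵀ * R⁻¹ * H) *ᵥ x)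
      (fun N => toEuclideanCLM (n := ι) (𝕜 := ℝ) (Y N)ᵀ) := by
  have hV : ∀ N (x : EuclideanSpace ℝ ι), ‖toEuclideanCLM (n := ι) (𝕜 := ℝ) (Y N)ᵀ x‖ ^ 2
      = x ⬝ᵥ backwardInfo Φ H (F * Fᵀ) R N *ᵥ x := fun N x => by
    rw [hY, dotProduct_mul_transpose_mulVec]
  have hw : ∀ w : EuclideanSpace ℝ ι, ‖w‖ ^ 2 = w ⬝ᵥ w := fun w => by
    rw [← real_inner_self_eq_norm_sq, EuclideanSpace.inner_eq_star_dotProduct, star_trivial]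
  have hsucc : ∀ N (x : EuclideanSpace ℝ ι), x ⬝ᵥ backwardInfo Φ H (F * Fᵀ) R (N + 1) *ᵥ x
      = x ⬝ᵥ (Hᵀ * R⁻¹ * H) *ᵥ x + (Φ *ᵥ x) ⬝ᵥ
        infoUpdate (backwardInfo Φ H (F * Fᵀ) R N) (F * Fᵀ) *ᵥ (Φ *ᵥ x) := fun N x => by
    rw [backwardInfo, add_mulVec, dotProduct_add, ← mulVec_mulVec _ _ Φ, ← mulVec_mulVec _ Φᵀ,
      dotProduct_mulVec _ Φᵀ, vecMul_transpose]
  refine ⟨fun x => ?_, fun N x w => ?_, fun N x => ?_⟩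
  · have := hV 0 x
    rw [backwardInfo, zero_mulVec, dotProduct_zero] at this
    exact norm_eq_zero.mp (pow_eq_zero_iff two_ne_zero |>.mp this)
  · have hJ := backwardInfo_posSemidef (Φ := Φ) (H := H) hF hR N
    have h1 := dotProduct_infoUpdate_add (F := F) hJ (Φ *ᵥ x) w
    rw [hV, hV, hw, hsucc]
    set d := w.ofLp + Fᵀ *ᵥ infoUpdate (backwardInfo Φ H (F * Fᵀ) R N) (F * Fᵀ) *ᵥ Φ *ᵥ x.ofLp
    have h2 : 0 ≤ d ⬝ᵥ d := by simpa using dotProduct_star_self_nonneg d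
    have h3 := hJ.dotProduct_mulVec_nonneg (F *ᵥ d)
    rw [star_trivial] at h3
    change _ ≤ _ + _ + (Φ *ᵥ x.ofLp + F *ᵥ w.ofLp) ⬝ᵥ _ *ᵥ (Φ *ᵥ x.ofLp + F *ᵥ w.ofLp)
    linarith
  · have hJ := backwardInfo_posSemidef (Φ := Φ) (H := H) hF hR N
    obtain ⟨w, hwz⟩ : ∃ w : ι → ℝ, w = -(Fᵀ *ᵥ infoUpdate (backwardInfo Φ H (F * Fᵀ) R N)
      (F * Fᵀ) *ᵥ Φ *ᵥ x.ofLp) := ⟨_, rfl⟩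
    have h1 := dotProduct_infoUpdate_add (F := F) hJ (Φ *ᵥ x) w
    have h2 : w + Fᵀ *ᵥ infoUpdate (backwardInfo Φ H (F * Fᵀ) R N) (F * Fᵀ) *ᵥ Φ *ᵥ x.ofLp = 0 := by
      rw [hwz, neg_add_cancel]
    rw [h2] at h1
    refine ⟨WithLp.toLp 2 w, ?_⟩
    rw [hV, hV, hw, hsucc]
    change _ = _ + w ⬝ᵥ w + (Φ *ᵥ x.ofLp + F *ᵥ w) ⬝ᵥ _ *ᵥ (Φ *ᵥ x.ofLp + F *ᵥ w)
    simp only [mulVec_zero, dotProduct_zero, add_zero] at h1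
    linarith

theorem norm_le_of_dotProduct_mulVec_le {S : Matrix ι ι ℝ} (hS : S.PosSemidef) {c : ℝ}
    (hc : 0 ≤ c) (h : ∀ x : EuclideanSpace ℝ ι, x ⬝ᵥ S *ᵥ x ≤ c * ‖x‖ ^ 2) : ‖S‖ ≤ c := by
  obtain ⟨Y, rfl⟩ := exists_eq_mul_transpose hS
  have h1 : ‖Yᵀ‖ ≤ √c := by
    rw [cstar_norm_def]
    refine ContinuousLinearMap.opNorm_le_bound _ (Real.sqrt_nonneg c) fun x => ?_
    refine le_of_sq_le_sq ?_ (by positivity)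
    rw [← dotProduct_mul_transpose_mulVec, mul_pow, Real.sq_sqrt hc]
    exact h x
  have h2 : ‖Y * Yᵀ‖ = ‖Yᵀ‖ * ‖Yᵀ‖ := by
    rw [← l2_opNorm_conjTranspose_mul_self, conjTranspose_eq_transpose_of_trivial,
      transpose_transpose]
  rw [h2, ← Real.mul_self_sqrt hc]
  exact mul_self_le_mul_self (norm_nonneg _) h1

theorem exists_geometric_covIncrement (Φ : Matrix ι ι ℝ) (H : Matrix κ ι ℝ) (hQ : Q.PosSemidef)
    (hR : R.PosDef) :
    ∃ c r : ℝ, 0 < c ∧ 0 < r ∧ r < 1 ∧ ∀ N : ℕ, 1 ≤ N → ‖covIncrement Φ H Q R N‖ ≤ c * r ^ N := by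
  obtain ⟨F, rfl⟩ := exists_eq_mul_transpose hQ
  have hJ := backwardInfo_posSemidef (Φ := Φ) (H := H) hQ hR
  choose Y hY using fun N => exists_eq_mul_transpose (hJ N)
  have hval := isValueIteration_backwardInfo hQ hR hY
  obtain ⟨c, r, hc, hr0, hr1, hbound⟩ :=
    hval.exists_geometric (toEuclideanCLM (n := ι) (𝕜 := ℝ) F) rfl
  have hform : ∀ N (w : EuclideanSpace ℝ ι),
      w ⬝ᵥ (Fᵀ * backwardInfo Φ H (F * Fᵀ) R N * F) *ᵥ w
        = ‖toEuclideanCLM (n := ι) (𝕜 := ℝ) (Y N)ᵀ (toEuclideanCLM (n := ι) (𝕜 := ℝ) F w)‖ ^ 2 :=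
    fun N w => by
      rw [← dotProduct_mul_transpose_mulVec, ← hY, ofLp_toEuclideanCLM, ← mulVec_mulVec,
        ← mulVec_mulVec, dotProduct_mulVec _ Fᵀ, vecMul_transpose]
  have hdiff : ∀ N, ‖Fᵀ * backwardInfo Φ H (F * Fᵀ) R (N + 1) * F
      - Fᵀ * backwardInfo Φ H (F * Fᵀ) R N * F‖ ≤ c * r ^ N := fun N => by
    refine norm_le_of_dotProduct_mulVec_le (.of_dotProduct_mulVec_nonneg ?_ fun x => ?_)
      (by positivity) fun x => ?_
    · exact (posSemidef_conj' (hJ (N + 1)) F).isHermitian.sub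
        (posSemidef_conj' (hJ N) F).isHermitian
    · have h1 := hform N (WithLp.toLp 2 x)
      have h2 := hform (N + 1) (WithLp.toLp 2 x)
      have h3 := hval.mono (toEuclideanCLM (n := ι) (𝕜 := ℝ) F (WithLp.toLp 2 x)) (Nat.le_succ N)
      simp only [← h1, ← h2] at h3
      rw [star_trivial, sub_mulVec, dotProduct_sub]
      exact sub_nonneg.mpr h3
    · rw [sub_mulVec, dotProduct_sub, hform, hform]
      exact hbound N x
  -- The `+ 1` keeps the constant positive when `F = 0`.
  refine ⟨‖F‖ * ‖F‖ * c + 1, r, by positivity, hr0, hr1, fun N hN => ?_⟩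
  obtain ⟨M, rfl⟩ : ∃ M, N = M + 1 := ⟨N - 1, by omega⟩
  rw [covIncrement_succ hQ hR]
  calc _ ≤ ‖F‖ * ‖F‖ * (c * r ^ (M + 1)) := (norm_infoUpdate_sub_le (hJ _) (hJ _)).trans
        (mul_le_mul_of_nonneg_left (hdiff (M + 1)) (by positivity))
    _ ≤ _ := by
      have : 0 ≤ r ^ (M + 1) := by positivity
      rw [add_mul]
      linarith

end InformationForm

end ObservedControl

/-- Neither stability of `A`, nor controllability of `(A, B)`, nor observability or detectability
is assumed. The measurement matrix `H` is arbitrary; it is `[[C, D], [0, I]]`, or some of the rows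
of that matrix, in the usual setting. Norms are `L²` operator norms. -/
theorem corollary2 (n m p : ℕ)
    (A : Matrix (Fin n) (Fin n) ℝ) (B : Matrix (Fin n) (Fin m) ℝ)
    (H : Matrix (Fin p) (Fin n ⊕ Fin m) ℝ)
    (Q : Matrix (Fin n ⊕ Fin m) (Fin n ⊕ Fin m) ℝ) (R : Matrix (Fin p) (Fin p) ℝ)
    (hQ : Q.PosSemidef) (hR : R.PosDef) :
    Tendsto (fun N : ℕ =>
        ObservedControl.covIncrement (ObservedControl.augmentedTransition A B) H Q R N)
      atTop (𝓝 0) ∧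
    ∃ c r : ℝ, 0 < c ∧ 0 < r ∧ r < 1 ∧ ∀ N : ℕ, 1 ≤ N →
      ‖ObservedControl.covIncrement (ObservedControl.augmentedTransition A B) H Q R N‖
        ≤ c * r ^ N := by
  obtain ⟨c, r, hc, hr0, hr1, h⟩ := ObservedControl.exists_geometric_covIncrement
    (ObservedControl.augmentedTransition A B) H hQ hR
  refine ⟨squeeze_zero_norm' (a := fun N => c * r ^ N) ?_ ?_, c, r, hc, hr0, hr1, h⟩
  · filter_upwards [eventually_ge_atTop 1] with N hN using h N hN
  · simpa using (tendsto_pow_atTop_nhds_zero_of_lt_one hr0.le hr1).const_mul c
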